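/- Let $K$ be an algebraically closed field of characteristic zero and let $f_1,\dots,f_n\in K[x]=K[x_1,\dots,x_n]$ have no common root at infinity, i.e. the homogeneous components $\tilde f_i$ of degree $\deg f_i$ of the $f_i$ have no common zero in $K^n\setminus\{0\}$. Put $I=(f_1,\dots,f_n)$, $A=K[x]/I$, and let $A^*$ be the dual of the $K$-vector space $A$. For $\alpha\in\mathbb N^n$ let $\partial_\alpha=\frac{1}{\alpha_1!\cdots\alpha_n!}\frac{\partial^{|\alpha|}}{\partial x_1^{\alpha_1}\cdots\partial x_n^{\alpha_n}}$, and let $K[[\partial]]$ be the $K$-vector space of formal sums $\mathbf D=\sum_\alpha a_\alpha\partial_\alpha$ ($a_\alpha\in K$), acting on polynomials by $\mathbf D(p)=\sum_\alpha a_\alpha\partial_\alpha(p)$ (a finite sum); write $1=\partial_0$. Let $\sigma_i:K[[\partial]]\to K[[\partial]]$ be given by $\sigma_i(\sum_\alpha a_\alpha\partial_\alpha)=\sum_{\alpha_i>0}a_\alpha\partial_{\alpha-e_i}$ and put $\sigma_\beta=\sigma_1^{\beta_1}\circ\cdots\circ\sigma_n^{\beta_n}$; a subspace $V\subset K[[\partial]]$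 is closed if it is finite-dimensional and $\sigma_\beta(V)\subset V$ for all $\beta\in\mathbb N^n$. For $\xi\in K^n$ let $\mathbf m_\xi\subset K[x]$ be its maximal ideal, put $\mathbf D|_\xi(p)=\mathbf D(p)(\xi)$, and for an ideal $J$ put $\Delta_\xi(J)=\{\mathbf D\in K[[\partial]]:\mathbf D|_\xi(p)=0\ \forall p\in J\}$. Let $I=Q_1\cap\dots\cap Q_m$ be a minimal primary decomposition of $I$ and let $d_i=\operatorname{mult}(Q_i)=\dim_K K[x]/Q_i$. Then there are distinct points $\xi_1,\dots,\xi_m\in K^n$, which are exactly the common roots of $f_1,\dots,f_n$, such that each $Q_i$ is $\mathbf m_{\xi_i}$-primary. For each $i$, $V_i=\Delta_{\xi_i}(Q_i)$ is a closed subspace of dimension $d_i\ge 1$ that contains $1$. Finally, for every choice of bases $\mathbf D_{i,1}=1,\mathbf D_{i,2},\dots,\mathbf D_{i,d_i}$ of $V_i$ ($1\le i\le m$), the functionals $\mathbf D_{i,k}|_{\xi_i}$ ($1\le i\le m$, $1\le k\le d_i$) are well defined on $A$ and form a basis of $A^*$ over $K$; in particular this basis contains the evaluation maps $\mathbf D_{i,1}|_{\xi_i}=\mathrm{ev}_{\xi_i}$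 at all common roots. -/

import Mathlib

namespace GroebnerDuality

open MvPolynomial

variable {K : Type*} [Field K] {n : ℕ}

/-- The operator `∂_α = (1 / (α₁! ⋯ αₙ!)) ∂^|α| / ∂x₁^α₁ ⋯ ∂xₙ^αₙ` on `K[x₁, …, xₙ]`. -/
noncomputable def dOp (α : Fin n →₀ ℕ) :
    MvPolynomial (Fin n) K →ₗ[K] MvPolynomial (Fin n) K :=
  ((∏ i, (α i).factorial : ℕ) : K)⁻¹ •
    ((List.finRange n).map fun i =>
      (((pderiv i : Derivation K (MvPolynomial (Fin n) K) (MvPolynomial (Fin n) K)) :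
        Module.End K (MvPolynomial (Fin n) K)) ^ α i)).prod

/-- All monomials of `p` have total degree less than `k`. -/
def DegLT (p : MvPolynomial (Fin n) K) (k : ℕ) : Prop := ∀ s, coeff s p ≠ 0 → s.degree < k

theorem DegLT.pderiv_pow {p : MvPolynomial (Fin n) K} {k : ℕ} (h : DegLT p k) (i : Fin n)
    (a : ℕ) :
    DegLT ((((pderiv i : Derivation K (MvPolynomial (Fin n) K) (MvPolynomial (Fin n) K)) :
        Module.End K (MvPolynomial (Fin n) K)) ^ a) p) (k - a) := by
  induction a with
  | zero => simpa using h
  | succ a ih =>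
    intro s hs
    rw [pow_succ', Module.End.mul_apply] at hs
    change coeff s (pderiv i _) ≠ 0 at hs
    rw [coeff_pderiv] at hs
    have := ih _ (left_ne_zero_of_mul hs)
    rw [map_add, Finsupp.degree_single] at this
    omega

theorem DegLT.listProd {p : MvPolynomial (Fin n) K} {k : ℕ} (h : DegLT p k) (α : Fin n →₀ ℕ)
    (l : List (Fin n)) :
    DegLT ((l.map fun i =>
      (((pderiv i : Derivation K (MvPolynomial (Fin n) K) (MvPolynomial (Fin n) K)) :
        Module.End K (MvPolynomial (Fin n) K)) ^ α i)).prod p) (k - (l.map fun i => α i).sum) := by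
  induction l with
  | nil => simpa using h
  | cons i l ih =>
    simp only [List.map_cons, List.prod_cons, List.sum_cons, Module.End.mul_apply]
    have := ih.pderiv_pow i (α i)
    rwa [Nat.sub_sub, Nat.add_comm] at this

/-- `∂_α p = 0` as soon as `|α|` exceeds the total degree of `p`. -/
theorem dOp_eq_zero {p : MvPolynomial (Fin n) K} {α : Fin n →₀ ℕ}
    (h : p.totalDegree < α.degree) : dOp α p = 0 := by
  have h0 : DegLT p (p.totalDegree + 1) := fun s hs =>
    Nat.lt_succ_of_le (le_totalDegree (mem_support_iff.mpr hs))
  have h1 := h0.listProd α (List.finRange n)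
  have h2 : ((List.finRange n).map fun i => α i).sum = α.degree := by
    rw [Finsupp.degree_eq_sum, ← List.ofFn_eq_map, List.sum_ofFn]
  rw [h2, Nat.sub_eq_zero_of_le h] at h1
  rw [dOp, LinearMap.smul_apply]
  convert smul_zero _
  ext s
  by_contra hs
  exact absurd (h1 s (by simpa using hs)) (Nat.not_lt_zero _)

/-- The `K`-vector space `K[[∂]]`: the family `a` stands for the formal sum `∑ a_α ∂_α`. -/
abbrev DiffSeries (K : Type*) (n : ℕ) : Type _ := (Fin n →₀ ℕ) → K

theorem finite_support_apply (D : DiffSeries K n) (p : MvPolynomial (Fin n) K) :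
    (Function.support fun α => D α • dOp α p).Finite := by
  refine (Finsupp.finite_of_degree_le (σ := Fin n) p.totalDegree).subset fun α hα => ?_
  by_contra h
  exact hα (by simp [dOp_eq_zero (not_le.mp h)])

namespace DiffSeries

/-- The element `1 = ∂_0` of `K[[∂]]`. -/
noncomputable def one : DiffSeries K n := Pi.single 0 1

/-- The action of `K[[∂]]` on polynomials, `(∑ a_α ∂_α) p = ∑ a_α ∂_α p`.
Only finitely many terms are nonzero (`finite_support_apply`). -/
noncomputable def act :
    DiffSeries K n →ₗ[K] MvPolynomial (Fin n) K →ₗ[K] MvPolynomial (Fin n) K :=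
  LinearMap.mk₂ K (fun D p => ∑ᶠ α, D α • dOp α p)
    (fun D E p => by
      rw [← finsum_add_distrib (finite_support_apply D p) (finite_support_apply E p)]
      simp only [Pi.add_apply, add_smul])
    (fun c D p => by
      rw [smul_finsum' c (finite_support_apply D p)]
      simp only [Pi.smul_apply, smul_eq_mul, mul_smul])
    (fun D p q => by
      rw [← finsum_add_distrib (finite_support_apply D p) (finite_support_apply D q)]
      simp only [map_add, smul_add])
    (fun c D p => by
      rw [smul_finsum' c (finite_support_apply D p)]
      simp only [map_smul, smul_comm c])

/-- The functional `D|_ξ : p ↦ D(p)(ξ)` on `K[x₁, …, xₙ]`. -/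
noncomputable def evalAt (ξ : Fin n → K) (D : DiffSeries K n) :
    MvPolynomial (Fin n) K →ₗ[K] K :=
  (aeval ξ).toLinearMap ∘ₗ act D

/-- `σ_i : K[[∂]] → K[[∂]]`, sending `∂_α` to `∂_{α - e_i}` if `α_i > 0` and to `0` otherwise;
thus the coefficient of `∂_α` in `σ_i D` is the coefficient of `∂_{α + e_i}` in `D`. -/
noncomputable def shift (i : Fin n) : DiffSeries K n →ₗ[K] DiffSeries K n where
  toFun D := fun α => D (α + Finsupp.single i 1)
  map_add' _ _ := rfl
  map_smul' _ _ := rfl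

/-- `σ_β = σ_1^β₁ ∘ ⋯ ∘ σ_n^βₙ`. -/
noncomputable def shifts (β : Fin n →₀ ℕ) : DiffSeries K n →ₗ[K] DiffSeries K n :=
  ((List.finRange n).map fun i => ((shift i : Module.End K (DiffSeries K n)) ^ β i)).prod

end DiffSeries

/-- A subspace of `K[[∂]]` is closed if it is finite-dimensional and stable under all `σ_β`. -/
def IsClosedSubspace (V : Submodule K (DiffSeries K n)) : Prop :=
  FiniteDimensional K V ∧ ∀ β : Fin n →₀ ℕ, ∀ D ∈ V, DiffSeries.shifts β D ∈ V

/-- `Δ_ξ(J) = {D ∈ K[[∂]] : D(p)(ξ) = 0 for all p ∈ J}`. -/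
noncomputable def deltaSpace (ξ : Fin n → K) (J : Ideal (MvPolynomial (Fin n) K)) :
    Submodule K (DiffSeries K n) where
  carrier := {D | ∀ p ∈ J, D.evalAt ξ p = 0}
  add_mem' hD hE p hp := by
    have h1 := hD p hp
    have h2 := hE p hp
    simp only [DiffSeries.evalAt, LinearMap.comp_apply, map_add, LinearMap.add_apply] at h1 h2 ⊢
    rw [h1, h2, add_zero]
  zero_mem' p _ := by simp [DiffSeries.evalAt]
  smul_mem' c D hD p hp := by
    have h1 := hD p hp
    simp only [DiffSeries.evalAt, LinearMap.comp_apply, map_smul, LinearMap.smul_apply] at h1 ⊢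
    rw [h1, smul_zero]

/-- The maximal ideal `m_ξ` of the point `ξ`. -/
noncomputable def pointIdeal (ξ : Fin n → K) : Ideal (MvPolynomial (Fin n) K) :=
  RingHom.ker (eval ξ)

/-- The multiplicity `dim_K K[x₁, …, xₙ] / Q` of an ideal `Q` primary to the ideal of a point. -/
noncomputable def mult (Q : Ideal (MvPolynomial (Fin n) K)) : ℕ :=
  Module.finrank K (MvPolynomial (Fin n) K ⧸ Q)

/-- The polynomials `f i` have no common root at infinity: over the algebraically closed field
`K`, their homogeneous components of top degree have no common zero other than the origin. -/
def NoRootsAtInfinity (f : Fin n → MvPolynomial (Fin n) K) : Prop :=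
  ∀ x : Fin n → K,
    (∀ i, eval x (homogeneousComponent (f i).totalDegree (f i)) = 0) → x = 0

end GroebnerDuality

namespace GroebnerDuality

open MvPolynomial

/-! ### Finite dimensionality of `K[x]/I` when there are no roots at infinity. -/

section Finiteness

variable {K : Type*} [Field K] {n : ℕ}

attribute [local instance] MvPolynomial.gradedAlgebra

/-! In characteristic zero, Taylor's formula at `ξ` identifies `K[[∂]]` with the full dual of `K[x]`
(`evalEquiv`, `evalAt_eq_evalEquiv`). Under this identification `Δ_ξ(J)` is the annihilator of `J`,
that is, the dual of `K[x]/J` (`deltaSpaceEquiv`), and `σ_i` is the transpose of multiplication by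
`x_i - ξ_i` (`evalAt_shift`), so ideals give stable subspaces.

Having no root at infinity makes `A` finite-dimensional (`finite_quotient_of_noRootsAtInfinity`),
hence every prime over `I` is the ideal of a point. The `Q_i` have distinct maximal radicals, so
they are pairwise coprime; dualizing the Chinese remainder isomorphism splits `A^*` into the
`Δ_{ξ_i}(Q_i)` (`exists_deltaSpace_pi_equiv`). -/

theorem homogeneousComponent_mul_of_isHomogeneous (c h : MvPolynomial (Fin n) K) {d e : ℕ}
    (hh : h.IsHomogeneous e) :
    homogeneousComponent d (c * h) =
      if e ≤ d then homogeneousComponent (d - e) c * h else 0 := by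
  have key (p : MvPolynomial (Fin n) K) (i : ℕ) :
      (DirectSum.decompose (homogeneousSubmodule (Fin n) K) p i : MvPolynomial (Fin n) K) =
        homogeneousComponent i p := decomposition.decompose'_apply p i
  split_ifs with hle
  · rw [← key, ← key]
    exact DirectSum.coe_decompose_mul_of_right_mem_of_le _ hh hle
  · rw [← key]
    exact DirectSum.coe_decompose_mul_of_right_mem_of_not_le _ hh hle

theorem degLT_sub_leading (f : MvPolynomial (Fin n) K) :
    DegLT (homogeneousComponent f.totalDegree f - f) f.totalDegree := by
  intro s hs
  rw [coeff_sub, coeff_homogeneousComponent] at hs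
  split_ifs at hs with h
  · simp at hs
  · have : coeff s f ≠ 0 := by simpa using hs
    exact lt_of_le_of_ne (le_totalDegree (mem_support_iff.mpr this)) h

theorem IsHomogeneous.mul_degLT {c g : MvPolynomial (Fin n) K} {a b : ℕ}
    (hc : c.IsHomogeneous a) (hg : DegLT g b) : DegLT (c * g) (a + b) := by
  classical
  intro s hs
  rw [coeff_mul] at hs
  obtain ⟨⟨u, v⟩, huv, h⟩ := Finset.exists_ne_zero_of_sum_ne_zero hs
  have h1 := hg v (right_ne_zero_of_mul h)
  have h2 : u.degree = a := by
    by_contra hne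
    exact left_ne_zero_of_mul h (hc.coeff_eq_zero hne)
  rw [← Finset.HasAntidiagonal.mem_antidiagonal.mp huv, map_add, h2]
  exact Nat.add_lt_add_left h1 a

/-- If the leading form ideal contains the monomial `x^s`, then `x^s` is congruent modulo the ideal
to a polynomial of smaller degree. -/
theorem exists_degLT_of_monomial_mem (f : Fin n → MvPolynomial (Fin n) K) (s : Fin n →₀ ℕ)
    (hs : monomial s 1 ∈ Ideal.span
      (Set.range fun i => homogeneousComponent (f i).totalDegree (f i))) :
    ∃ q, DegLT q s.degree ∧ monomial s 1 - q ∈ Ideal.span (Set.range f) := by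
  obtain ⟨c, hc⟩ := Ideal.mem_span_range_iff_exists_fun.mp hs
  -- Only the part of each cofactor that contributes in degree `|s|` is kept; the case split guards
  -- against truncated subtraction.
  let c' : Fin n → MvPolynomial (Fin n) K := fun i =>
    if (f i).totalDegree ≤ s.degree then
      homogeneousComponent (s.degree - (f i).totalDegree) (c i) else 0
  have hc' : ∑ i, c' i * homogeneousComponent (f i).totalDegree (f i) = monomial s 1 := by
    have h1 : homogeneousComponent s.degree (monomial s (1 : K)) = monomial s 1 :=
      homogeneousComponent_eq_self (isHomogeneous_monomial 1 rfl)
    rw [← hc, map_sum, hc] at h1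
    rw [← h1]
    refine Finset.sum_congr rfl fun i _ => ?_
    rw [homogeneousComponent_mul_of_isHomogeneous _ _ (homogeneousComponent_isHomogeneous _ _)]
    simp only [c', ite_mul, zero_mul]
  -- Replacing each leading form by `f i` costs only terms of degree below `|s|`.
  refine ⟨∑ i, c' i * (homogeneousComponent (f i).totalDegree (f i) - f i), ?_, ?_⟩
  · intro t ht
    rw [coeff_sum] at ht
    obtain ⟨i, -, hi⟩ := Finset.exists_ne_zero_of_sum_ne_zero ht
    by_cases hle : (f i).totalDegree ≤ s.degree
    · have := IsHomogeneous.mul_degLT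
        (homogeneousComponent_isHomogeneous (s.degree - (f i).totalDegree) (c i))
        (degLT_sub_leading (f i)) t (by simpa only [c', if_pos hle] using hi)
      rwa [Nat.sub_add_cancel hle] at this
    · simp [c', hle] at hi
  · simp only [mul_sub, Finset.sum_sub_distrib, hc', sub_sub_cancel]
    exact Ideal.sum_mem _ fun i _ =>
      Ideal.mul_mem_left _ _ (Ideal.subset_span (Set.mem_range_self i))

/-- By the Nullstellensatz the radical of the leading form ideal contains all variables, so the
ideal contains a power of `(x_1, …, x_n)`. -/
theorem exists_monomial_mem_leading [IsAlgClosed K] {f : Fin n → MvPolynomial (Fin n) K}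
    (hf : NoRootsAtInfinity f) :
    ∃ N, ∀ s : Fin n →₀ ℕ, N ≤ s.degree → monomial s 1 ∈ Ideal.span
      (Set.range fun i => homogeneousComponent (f i).totalDegree (f i)) := by
  set J := Ideal.span (Set.range fun i => homogeneousComponent (f i).totalDegree (f i))
  have hle : Ideal.span (Set.range (X : Fin n → MvPolynomial (Fin n) K)) ≤ J.radical := by
    rw [← vanishingIdeal_zeroLocus_eq_radical (K := K), Ideal.span_le]
    rintro _ ⟨i, rfl⟩ x hx
    have : x = 0 := hf x fun j => by
      simpa [aeval_eq_eval] using hx _ (Ideal.subset_span (Set.mem_range_self j))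
    simp [this]
  obtain ⟨N, hN⟩ := Ideal.exists_pow_le_of_le_radical_of_fg hle
    ⟨(Set.finite_range X).toFinset, by simp⟩
  refine ⟨N, fun s hs => hN (Ideal.pow_le_pow_right hs ?_)⟩
  rw [Ideal.span_pow_eq_map_homogeneousSubmodule]
  exact ⟨monomial s 1, isHomogeneous_monomial 1 rfl, by
    rw [AlgHom.toLinearMap_apply, aeval_monomial, monomial_eq, map_one, map_one]⟩

/-- Strong induction on degree rewrites every monomial of large degree modulo `I`, so those of
degree at most `N` span. -/
theorem finite_quotient_of_noRootsAtInfinity [IsAlgClosed K]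
    {f : Fin n → MvPolynomial (Fin n) K} (hf : NoRootsAtInfinity f) :
    Module.Finite K (MvPolynomial (Fin n) K ⧸ Ideal.span (Set.range f)) := by
  obtain ⟨N, hN⟩ := exists_monomial_mem_leading hf
  let π := (Ideal.Quotient.mkₐ K (Ideal.span (Set.range f))).toLinearMap
  let S : Set (MvPolynomial (Fin n) K ⧸ Ideal.span (Set.range f)) :=
    (fun s => π (monomial s 1)) '' {s : Fin n →₀ ℕ | s.degree ≤ N}
  have hS : S.Finite := (Finsupp.finite_of_degree_le (σ := Fin n) N).image _
  have hq (q : MvPolynomial (Fin n) K)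
      (h : ∀ s ∈ q.support, π (monomial s 1) ∈ Submodule.span K S) :
      π q ∈ Submodule.span K S := by
    rw [q.as_sum, map_sum]
    refine Submodule.sum_mem _ fun s hs => ?_
    rw [← mul_one (coeff s q), ← smul_eq_mul, ← smul_monomial, map_smul]
    exact Submodule.smul_mem _ _ (h s hs)
  have hmon (d : ℕ) : ∀ s : Fin n →₀ ℕ, s.degree = d → π (monomial s 1) ∈ Submodule.span K S := by
    induction d using Nat.strong_induction_on with
    | _ d ih =>
      rintro s rfl
      rcases le_total s.degree N with hs | hs
      · exact Submodule.subset_span ⟨s, hs, rfl⟩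
      · obtain ⟨q, hdeg, hmem⟩ := exists_degLT_of_monomial_mem f s (hN s hs)
        have : π (monomial s 1) = π q := Ideal.Quotient.eq.mpr hmem
        rw [this]
        exact hq q fun t ht => ih _ (hdeg t (mem_support_iff.mp ht)) t rfl
  refine ⟨⟨hS.toFinset, ?_⟩⟩
  rw [hS.coe_toFinset, eq_top_iff]
  rintro x -
  obtain ⟨p, rfl⟩ := Ideal.Quotient.mk_surjective x
  exact hq p fun s _ => hmon _ s rfl

end Finiteness

/-! ### Taylor's formula and the duality between `K[[∂]]` and `K[x]`. -/

section Taylor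

variable {K : Type*} [Field K] {n : ℕ}

/-- The translation `p ↦ p(x + ξ)`. -/
noncomputable def translate (ξ : Fin n → K) :
    MvPolynomial (Fin n) K ≃ₐ[K] MvPolynomial (Fin n) K :=
  AlgEquiv.ofAlgHom (aeval fun i => X i + C (ξ i)) (aeval fun i => X i - C (ξ i))
    (by ext i; simp [← algebraMap_eq]) (by ext i; simp [← algebraMap_eq])

@[simp]
theorem translate_X (ξ : Fin n → K) (i : Fin n) : translate ξ (X i) = X i + C (ξ i) := by
  simp [translate]

@[simp]
theorem translate_C (ξ : Fin n → K) (c : K) : translate ξ (C c) = C c :=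
  (translate ξ).commutes c

theorem pderiv_translate (ξ : Fin n → K) (i : Fin n) (p : MvPolynomial (Fin n) K) :
    pderiv i (translate ξ p) = translate ξ (pderiv i p) := by
  induction p using MvPolynomial.induction_on with
  | C a => simp
  | add p q hp hq => simp [hp, hq]
  | mul_X p j hp =>
    have : translate ξ (pderiv i (X j)) = (pderiv i (X j) : MvPolynomial (Fin n) K) := by
      rw [pderiv_X]
      by_cases h : j = i
      · subst h; simp
      · simp [h]
    rw [map_mul, Derivation.leibniz, Derivation.leibniz, map_add, hp, smul_eq_mul, smul_eq_mul,
      smul_eq_mul, smul_eq_mul, map_mul, map_mul, this, translate_X, map_add, pderiv_C, add_zero]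

theorem pderiv_list_prod_translate (ξ : Fin n → K) (α : Fin n →₀ ℕ) (l : List (Fin n))
    (p : MvPolynomial (Fin n) K) :
    ((l.map fun i =>
      (((pderiv i : Derivation K (MvPolynomial (Fin n) K) (MvPolynomial (Fin n) K)) :
        Module.End K (MvPolynomial (Fin n) K)) ^ α i)).prod (translate ξ p)) =
    translate ξ ((l.map fun i =>
      (((pderiv i : Derivation K (MvPolynomial (Fin n) K) (MvPolynomial (Fin n) K)) :
        Module.End K (MvPolynomial (Fin n) K)) ^ α i)).prod p) := by
  induction l with
  | nil => simp
  | cons i l ih =>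
    simp only [List.map_cons, List.prod_cons, Module.End.mul_apply, ih]
    generalize (List.prod (List.map _ l) : Module.End K (MvPolynomial (Fin n) K)) p = q
    induction α i with
    | zero => simp
    | succ a iha =>
      rw [pow_succ', Module.End.mul_apply, iha, Module.End.mul_apply]
      exact pderiv_translate ξ i _

theorem dOp_translate (ξ : Fin n → K) (α : Fin n →₀ ℕ) (p : MvPolynomial (Fin n) K) :
    dOp α (translate ξ p) = translate ξ (dOp α p) := by
  simp only [dOp, LinearMap.smul_apply, pderiv_list_prod_translate, map_smul]

theorem coeff_pderiv_pow (i : Fin n) (a : ℕ) (p : MvPolynomial (Fin n) K) (s : Fin n →₀ ℕ) :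
    coeff s ((((pderiv i : Derivation K (MvPolynomial (Fin n) K) (MvPolynomial (Fin n) K)) :
        Module.End K (MvPolynomial (Fin n) K)) ^ a) p) =
      coeff (s + Finsupp.single i a) p * ((s i + 1).ascFactorial a : ℕ) := by
  induction a generalizing p with
  | zero => simp
  | succ a ih =>
    rw [pow_succ, Module.End.mul_apply, ih]
    change coeff _ (pderiv i p) * _ = _
    rw [coeff_pderiv, add_assoc, ← Finsupp.single_add, Nat.ascFactorial_succ]
    simp only [Finsupp.add_apply, Finsupp.single_eq_same]
    push_cast
    ring

/-- Vanishing of `s` on `l` turns each ascending factorial into `α_i!`; `Nodup` preserves this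
vanishing on the tail after `s` is raised in direction `i`. -/
theorem coeff_pderiv_list_prod (α : Fin n →₀ ℕ) (p : MvPolynomial (Fin n) K)
    (l : List (Fin n)) (hl : l.Nodup) (s : Fin n →₀ ℕ) (hs : ∀ i ∈ l, s i = 0) :
    coeff s ((l.map fun i =>
      (((pderiv i : Derivation K (MvPolynomial (Fin n) K) (MvPolynomial (Fin n) K)) :
        Module.End K (MvPolynomial (Fin n) K)) ^ α i)).prod p) =
    coeff (s + (l.map fun i => Finsupp.single i (α i)).sum) p *
      ((l.map fun i => (α i).factorial).prod : ℕ) := by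
  induction l generalizing s with
  | nil => simp
  | cons i l ih =>
    obtain ⟨hi, hl⟩ := List.nodup_cons.mp hl
    simp only [List.map_cons, List.prod_cons, List.sum_cons, Module.End.mul_apply]
    rw [coeff_pderiv_pow, hs i List.mem_cons_self, ih hl, zero_add, Nat.one_ascFactorial, add_assoc]
    · push_cast; ring
    · intro j hj
      have : i ≠ j := fun h => hi (h ▸ hj)
      simp [hs j (List.mem_cons_of_mem _ hj), this]

theorem coeff_zero_dOp [CharZero K] (α : Fin n →₀ ℕ) (p : MvPolynomial (Fin n) K) :
    coeff 0 (dOp α p) = coeff α p := by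
  rw [dOp, LinearMap.smul_apply, coeff_smul,
    coeff_pderiv_list_prod α p _ (List.nodup_finRange n) 0 fun _ _ => rfl]
  have h1 : ((List.finRange n).map fun i => Finsupp.single i (α i)).sum = α := by
    rw [← List.ofFn_eq_map, List.sum_ofFn, Finsupp.univ_sum_single]
  have h2 : ((List.finRange n).map fun i => (α i).factorial).prod = ∏ i, (α i).factorial := by
    rw [← List.ofFn_eq_map, List.prod_ofFn]
  have h3 : ((∏ i, (α i).factorial : ℕ) : K) ≠ 0 :=
    Nat.cast_ne_zero.mpr (Finset.prod_ne_zero_iff.mpr fun i _ => Nat.factorial_ne_zero _)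
  rw [h1, h2, zero_add, smul_eq_mul, mul_comm, mul_assoc, mul_inv_cancel₀ h3, mul_one]

theorem eval_eq_coeff_zero_translate (ξ : Fin n → K) (p : MvPolynomial (Fin n) K) :
    eval ξ p = coeff 0 (translate ξ p) := by
  rw [← constantCoeff_eq]
  induction p using MvPolynomial.induction_on with
  | C a => simp
  | add p q hp hq => simp [hp, hq]
  | mul_X p j hp => simp [hp]

/-- Taylor's formula: `∂_α p (ξ)` is the coefficient of `x^α` in `p(x + ξ)`. -/
theorem eval_dOp [CharZero K] (ξ : Fin n → K) (α : Fin n →₀ ℕ) (p : MvPolynomial (Fin n) K) :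
    eval ξ (dOp α p) = coeff α (translate ξ p) := by
  rw [eval_eq_coeff_zero_translate, ← dOp_translate, coeff_zero_dOp]

/-- `K[[∂]]` is the algebraic dual of the polynomial ring, via `D ↦ D|_ξ`. -/
noncomputable def evalEquiv (ξ : Fin n → K) :
    DiffSeries K n ≃ₗ[K] Module.Dual K (MvPolynomial (Fin n) K) :=
  -- A coefficient family is a functional given by its values on monomials; translation moves `ξ` to
  -- the origin.
  (basisMonomials (Fin n) K).constr K ≪≫ₗ (translate ξ).toLinearEquiv.dualMap

theorem evalEquiv_apply (ξ : Fin n → K) (D : DiffSeries K n) (p : MvPolynomial (Fin n) K) :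
    evalEquiv ξ D p = (basisMonomials (Fin n) K).constr K D (translate ξ p) := rfl

theorem evalAt_eq_evalEquiv [CharZero K] (ξ : Fin n → K) (D : DiffSeries K n) :
    D.evalAt ξ = evalEquiv ξ D := by
  refine LinearMap.ext fun p => ?_
  rw [evalEquiv_apply, Module.Basis.constr_apply]
  change aeval ξ (∑ᶠ α, D α • dOp α p) =
    ∑ α ∈ (translate ξ p).support, coeff α (translate ξ p) • D α
  have h := AddMonoidHom.map_finsum (aeval ξ : MvPolynomial (Fin n) K →ₐ[K] K).toAddMonoidHom
    (finite_support_apply D p)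
  refine h.trans ?_
  have h2 (α : Fin n →₀ ℕ) : (aeval ξ : MvPolynomial (Fin n) K →ₐ[K] K).toAddMonoidHom
      (D α • dOp α p) = coeff α (translate ξ p) • D α := by
    change aeval ξ (D α • dOp α p) = _
    rw [map_smul, aeval_eq_eval, eval_dOp, smul_eq_mul, smul_eq_mul, mul_comm]
  simp only [h2]
  refine finsum_eq_sum_of_support_subset _ fun α hα => ?_
  exact mem_support_iff.mpr (left_ne_zero_of_mul hα)

theorem evalAt_one [CharZero K] (ξ : Fin n → K) (p : MvPolynomial (Fin n) K) :
    DiffSeries.one.evalAt ξ p = eval ξ p := by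
  classical
  rw [evalAt_eq_evalEquiv, evalEquiv_apply, Module.Basis.constr_apply, eval_eq_coeff_zero_translate]
  change ∑ α ∈ (translate ξ p).support, coeff α (translate ξ p) • DiffSeries.one α = _
  simp [DiffSeries.one, Pi.single_apply]
  tauto

/-- Translation sends `x_i - ξ_i` to `x_i`, and on monomials multiplication by `x_i` is exactly the
index shift. -/
theorem evalAt_shift [CharZero K] (ξ : Fin n → K) (i : Fin n) (D : DiffSeries K n)
    (p : MvPolynomial (Fin n) K) :
    (DiffSeries.shift i D).evalAt ξ p = D.evalAt ξ ((X i - C (ξ i)) * p) := by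
  have key : (basisMonomials (Fin n) K).constr K (DiffSeries.shift i D) =
      (basisMonomials (Fin n) K).constr K D ∘ₗ LinearMap.mulLeft K (X i) := by
    refine (basisMonomials (Fin n) K).ext fun s => ?_
    rw [Module.Basis.constr_basis]
    have : LinearMap.mulLeft K (X i) (basisMonomials (Fin n) K s) =
        basisMonomials (Fin n) K (s + Finsupp.single i 1) := by
      simp [X, add_comm]
    rw [LinearMap.comp_apply, this, Module.Basis.constr_basis]
    rfl
  rw [evalAt_eq_evalEquiv, evalAt_eq_evalEquiv, evalEquiv_apply, evalEquiv_apply, key]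
  simp

end Taylor

/-! ### The spaces `Δ_ξ(J)` as duals of quotients. -/

section DeltaSpace

variable {K : Type*} [Field K] {n : ℕ}

theorem mem_deltaSpace {ξ : Fin n → K} {J : Ideal (MvPolynomial (Fin n) K)} {D : DiffSeries K n} :
    D ∈ deltaSpace ξ J ↔ ∀ p ∈ J, D.evalAt ξ p = 0 := Iff.rfl

variable [CharZero K]

theorem deltaSpace_eq_comap (ξ : Fin n → K) (J : Ideal (MvPolynomial (Fin n) K)) :
    deltaSpace ξ J = (J.restrictScalars K).dualAnnihilator.comap (evalEquiv ξ).toLinearMap := by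
  ext D
  simp [mem_deltaSpace, evalAt_eq_evalEquiv, Submodule.mem_dualAnnihilator]

/-- `Δ_ξ(J)` is the dual of `K[x] / J`. -/
noncomputable def deltaSpaceEquiv (ξ : Fin n → K) (J : Ideal (MvPolynomial (Fin n) K)) :
    deltaSpace ξ J ≃ₗ[K] Module.Dual K (MvPolynomial (Fin n) K ⧸ J) :=
  LinearEquiv.ofEq _ _ (deltaSpace_eq_comap ξ J) ≪≫ₗ
    (evalEquiv ξ).ofSubmodule' (J.restrictScalars K).dualAnnihilator ≪≫ₗ
    (J.restrictScalars K).dualQuotEquivDualAnnihilator.symm ≪≫ₗ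
    (Submodule.Quotient.restrictScalarsEquiv K J).symm.dualMap

theorem deltaSpaceEquiv_mk (ξ : Fin n → K) (J : Ideal (MvPolynomial (Fin n) K))
    (D : deltaSpace ξ J) (p : MvPolynomial (Fin n) K) :
    deltaSpaceEquiv ξ J D (Ideal.Quotient.mk J p) = (D : DiffSeries K n).evalAt ξ p := by
  have h := Submodule.dualQuotEquivDualAnnihilator_symm_apply_mk (J.restrictScalars K)
    ((evalEquiv ξ).ofSubmodule' (J.restrictScalars K).dualAnnihilator
      (LinearEquiv.ofEq _ _ (deltaSpace_eq_comap ξ J) D)) p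
  rw [evalAt_eq_evalEquiv]
  exact h

theorem shifts_mem_deltaSpace {ξ : Fin n → K} {J : Ideal (MvPolynomial (Fin n) K)}
    {D : DiffSeries K n} (hD : D ∈ deltaSpace ξ J) (β : Fin n →₀ ℕ) :
    DiffSeries.shifts β D ∈ deltaSpace ξ J := by
  have h1 (i : Fin n) (E : DiffSeries K n) (hE : E ∈ deltaSpace ξ J) :
      DiffSeries.shift i E ∈ deltaSpace ξ J := fun p hp => by
    rw [evalAt_shift]
    exact hE _ (J.mul_mem_left _ hp)
  rw [DiffSeries.shifts]
  induction List.finRange n with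
  | nil => simpa
  | cons i l ih =>
    rw [List.map_cons, List.prod_cons, Module.End.mul_apply]
    generalize (List.prod (List.map _ l) : Module.End K (DiffSeries K n)) D = E at ih ⊢
    induction β i with
    | zero => simpa
    | succ a iha =>
      rw [pow_succ', Module.End.mul_apply]
      exact h1 _ _ iha

theorem isClosedSubspace_deltaSpace (ξ : Fin n → K) (J : Ideal (MvPolynomial (Fin n) K))
    [Module.Finite K (MvPolynomial (Fin n) K ⧸ J)] : IsClosedSubspace (deltaSpace ξ J) :=
  ⟨Module.Finite.equiv (deltaSpaceEquiv ξ J).symm, fun β _ hD => shifts_mem_deltaSpace hD β⟩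

theorem finrank_deltaSpace (ξ : Fin n → K) (J : Ideal (MvPolynomial (Fin n) K)) :
    Module.finrank K (deltaSpace ξ J) = mult J :=
  (deltaSpaceEquiv ξ J).finrank_eq.trans Subspace.dual_finrank_eq

theorem one_mem_deltaSpace {ξ : Fin n → K} {J : Ideal (MvPolynomial (Fin n) K)}
    (h : J ≤ pointIdeal ξ) : DiffSeries.one ∈ deltaSpace ξ J := fun p hp => by
  rw [evalAt_one]
  exact h hp

/-- The dual of the quotient by an intersection of pairwise coprime ideals `Q i` is the product
of the spaces `Δ_{ξ i}(Q i)`. -/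
theorem exists_deltaSpace_pi_equiv {m : ℕ} (ξ : Fin m → Fin n → K)
    (Q : Fin m → Ideal (MvPolynomial (Fin n) K))
    (hQ : Pairwise (Function.onFun IsCoprime Q)) {I : Ideal (MvPolynomial (Fin n) K)}
    (hI : ⨅ i, Q i = I) :
    ∃ e : (∀ i, deltaSpace (ξ i) (Q i)) ≃ₗ[K] Module.Dual K (MvPolynomial (Fin n) K ⧸ I),
      ∀ D p, e D (Ideal.Quotient.mk I p) = ∑ i, (D i : DiffSeries K n).evalAt (ξ i) p := by
  subst hI
  let φ : (MvPolynomial (Fin n) K ⧸ ⨅ i, Q i) ≃ₗ[K] ∀ i, MvPolynomial (Fin n) K ⧸ Q i :=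
    { Ideal.quotientInfRingEquivPiQuotient Q hQ with
      map_smul' := fun c x => by
        obtain ⟨p, rfl⟩ := Ideal.Quotient.mk_surjective x
        rfl }
  -- `LinearMap.lsum` identifies a finite product of duals with the dual of the product.
  refine ⟨LinearEquiv.piCongrRight (fun i => deltaSpaceEquiv (ξ i) (Q i)) ≪≫ₗ
    LinearMap.lsum K (fun i => MvPolynomial (Fin n) K ⧸ Q i) K ≪≫ₗ φ.dualMap, fun D p => ?_⟩
  simp only [← deltaSpaceEquiv_mk]
  change (LinearMap.lsum K (fun i => MvPolynomial (Fin n) K ⧸ Q i) K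
    fun i => deltaSpaceEquiv (ξ i) (Q i) (D i)) (fun i => Ideal.Quotient.mk (Q i) p) = _
  simp [LinearMap.lsum_apply]

end DeltaSpace

/-! ### Point ideals and coprimality. -/

section Points

variable {K : Type*} [Field K] {n : ℕ}

instance (ξ : Fin n → K) : (pointIdeal ξ).IsMaximal :=
  RingHom.ker_isMaximal_of_surjective _ fun c => ⟨C c, eval_C c⟩

theorem pointIdeal_injective :
    Function.Injective (pointIdeal : (Fin n → K) → Ideal (MvPolynomial (Fin n) K)) := by
  intro ξ η h
  funext i
  have : X i - C (ξ i) ∈ pointIdeal η := h ▸ by simp [pointIdeal, RingHom.mem_ker]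
  have h2 : η i - ξ i = 0 := by simpa [pointIdeal, RingHom.mem_ker] using this
  exact (sub_eq_zero.mp h2).symm

/-- The quotient by `P` is an Artinian domain, hence a field, and the Nullstellensatz applies. -/
theorem exists_eq_pointIdeal [IsAlgClosed K] {I P : Ideal (MvPolynomial (Fin n) K)}
    [Module.Finite K (MvPolynomial (Fin n) K ⧸ I)] [P.IsPrime] (h : I ≤ P) :
    ∃ ξ, P = pointIdeal ξ := by
  have : Module.Finite K (MvPolynomial (Fin n) K ⧸ P) :=
    Module.Finite.of_surjective (Ideal.Quotient.factorₐ K h).toLinearMap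
      (Ideal.Quotient.factor_surjective h)
  have : IsArtinianRing (MvPolynomial (Fin n) K ⧸ P) := isArtinian_of_tower K inferInstance
  have hmax : P.IsMaximal := Ideal.Quotient.maximal_of_isField _
    (IsArtinianRing.isField_of_isDomain _)
  obtain ⟨ξ, hξ⟩ := (isMaximal_iff_eq_vanishingIdeal_singleton (K := K)).mp hmax
  refine ⟨ξ, hξ.trans ?_⟩
  ext p
  rw [mem_vanishingIdeal_singleton_iff, pointIdeal, RingHom.mem_ker, aeval_eq_eval]

theorem isCoprime_of_radical_eq_pointIdeal {I J : Ideal (MvPolynomial (Fin n) K)}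
    {ξ η : Fin n → K} (hI : I.radical = pointIdeal ξ) (hJ : J.radical = pointIdeal η)
    (h : ξ ≠ η) : IsCoprime I J := by
  rw [Ideal.isCoprime_iff_sup_eq, ← Ideal.radical_eq_top, Ideal.radical_sup, hI, hJ,
    Ideal.isCoprime_iff_sup_eq.mp (Ideal.isCoprime_of_isMaximal (pointIdeal_injective.ne h)),
    Ideal.radical_top]

end Points

end GroebnerDuality

open GroebnerDuality MvPolynomial

theorem mainTheorem5 {K : Type*} [Field K] [CharZero K] [IsAlgClosed K] {n : ℕ}
    (f : Fin n → MvPolynomial (Fin n) K) (hf : GroebnerDuality.NoRootsAtInfinity f)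
    {m : ℕ} (Q : Fin m → Ideal (MvPolynomial (Fin n) K)) (hQ : Function.Injective Q)
    (hdec : Submodule.IsMinimalPrimaryDecomposition (Ideal.span (Set.range f))
      (Finset.univ.map ⟨Q, hQ⟩)) :
    ∃ ξ : Fin m → Fin n → K,
      Function.Injective ξ ∧
      Set.range ξ = {x | ∀ j, MvPolynomial.eval x (f j) = 0} ∧
      (∀ i, (Q i).radical = GroebnerDuality.pointIdeal (ξ i)) ∧
      (∀ i, GroebnerDuality.IsClosedSubspace (GroebnerDuality.deltaSpace (ξ i) (Q i)) ∧
        Module.finrank K (GroebnerDuality.deltaSpace (ξ i) (Q i)) = GroebnerDuality.mult (Q i) ∧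
        0 < GroebnerDuality.mult (Q i) ∧
        GroebnerDuality.DiffSeries.one ∈ GroebnerDuality.deltaSpace (ξ i) (Q i)) ∧
      ∀ D : ∀ i, Module.Basis (Fin (GroebnerDuality.mult (Q i))) K
          (GroebnerDuality.deltaSpace (ξ i) (Q i)),
        (∀ i (k : Fin (GroebnerDuality.mult (Q i))), (k : ℕ) = 0 →
          (D i k : GroebnerDuality.DiffSeries K n) = GroebnerDuality.DiffSeries.one) →
        ∃ Λ : Module.Basis (Σ i, Fin (GroebnerDuality.mult (Q i))) K
            (Module.Dual K (MvPolynomial (Fin n) K ⧸ Ideal.span (Set.range f))),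
          (∀ i k p, Λ ⟨i, k⟩ (Ideal.Quotient.mk (Ideal.span (Set.range f)) p) =
            GroebnerDuality.DiffSeries.evalAt (ξ i) (D i k) p) ∧
          ∀ i (k : Fin (GroebnerDuality.mult (Q i))) p, (k : ℕ) = 0 →
            Λ ⟨i, k⟩ (Ideal.Quotient.mk (Ideal.span (Set.range f)) p) =
              MvPolynomial.eval (ξ i) p := by
  classical
  have hfin := finite_quotient_of_noRootsAtInfinity hf
  have hinf : ⨅ i, Q i = Ideal.span (Set.range f) := by
    rw [← hdec.inf_eq, Finset.inf_map, Finset.inf_univ_eq_iInf]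
    rfl
  have hle (i : Fin m) : Ideal.span (Set.range f) ≤ Q i := hinf ▸ iInf_le Q i
  have hmem (i : Fin m) : Q i ∈ Finset.univ.map ⟨Q, hQ⟩ := by simp
  have hprim (i : Fin m) : (Q i).IsPrimary := hdec.primary (hmem i)
  have hprime (i : Fin m) : (Q i).radical.IsPrime := Ideal.isPrime_radical (hprim i)
  choose ξ hξ using fun i => exists_eq_pointIdeal ((hle i).trans (Q i).le_radical)
  have hQξ (i : Fin m) : Q i ≤ pointIdeal (ξ i) := (hξ i) ▸ (Q i).le_radical
  have hinj : Function.Injective ξ := by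
    intro i j hij
    by_contra hne
    -- Minimality makes the radicals distinct, and the radicals determine the points.
    have := hdec.distinct (hmem i) (hmem j) (hQ.ne hne)
    simp only [Function.onFun, Submodule.colon_univ] at this
    exact this (by rw [hξ, hξ, hij])
  have hcop : Pairwise (Function.onFun IsCoprime Q) := fun i j hij =>
    isCoprime_of_radical_eq_pointIdeal (hξ i) (hξ j) (hinj.ne hij)
  have hfinQ (i : Fin m) : Module.Finite K (MvPolynomial (Fin n) K ⧸ Q i) :=
    Module.Finite.of_surjective (Ideal.Quotient.factorₐ K (hle i)).toLinearMap
      (Ideal.Quotient.factor_surjective (hle i))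
  refine ⟨ξ, hinj, ?_, hξ, fun i => ⟨isClosedSubspace_deltaSpace _ _, finrank_deltaSpace _ _, ?_,
    one_mem_deltaSpace (hQξ i)⟩, fun D hD => ?_⟩
  · ext x
    constructor
    · rintro ⟨i, rfl⟩ j
      exact hQξ i (hle i (Ideal.subset_span (Set.mem_range_self j)))
    · intro hx
      have hxI : Ideal.span (Set.range f) ≤ pointIdeal x :=
        Ideal.span_le.mpr (Set.range_subset_iff.mpr hx)
      -- A prime containing a finite intersection contains some `Q i`, hence its radical, which is
      -- maximal.
      rw [← hinf, ← Finset.inf_univ_eq_iInf, Ideal.IsPrime.inf_le' inferInstance] at hxI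
      obtain ⟨i, -, hi⟩ := hxI
      have h1 : pointIdeal (ξ i) ≤ pointIdeal x :=
        hξ i ▸ (Ideal.IsPrime.radical_le_iff inferInstance).mpr hi
      exact ⟨i, pointIdeal_injective
        (Ideal.IsMaximal.eq_of_le inferInstance (Ideal.IsPrime.ne_top inferInstance) h1)⟩
  · have : Nontrivial (MvPolynomial (Fin n) K ⧸ Q i) :=
      Ideal.Quotient.nontrivial_iff.mpr (hprim i).ne_top
    exact Module.finrank_pos
  · obtain ⟨e, he⟩ := exists_deltaSpace_pi_equiv ξ Q hcop hinf
    have hΛ (i : Fin m) (k : Fin (mult (Q i))) (p : MvPolynomial (Fin n) K) :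
        (Pi.basis D).map e ⟨i, k⟩ (Ideal.Quotient.mk (Ideal.span (Set.range f)) p) =
          DiffSeries.evalAt (ξ i) (D i k) p := by
      -- The basis vector at `⟨i, k⟩` is concentrated in coordinate `i`, so one summand survives.
      rw [Module.Basis.map_apply, he, Finset.sum_eq_single i, Pi.basis_apply, Pi.single_eq_same]
      · intro j _ hj
        rw [Pi.basis_apply, Pi.single_eq_of_ne hj]
        simp [evalAt_eq_evalEquiv]
      · simp
    refine ⟨(Pi.basis D).map e, hΛ, fun i k p hk => ?_⟩
    rw [hΛ, hD i k hk, evalAt_one]
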